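/- Terminology. For a simplicial set $X$, let $X^\sharp$ be the poset of its non-degenerate simplices, with $x\le x'$ when $x$ is a face of $x'$. A simplicial map $f:X\to Y$ induces an order-preserving map $f^\sharp:X^\sharp\to Y^\sharp$ that sends $x$ to the unique non-degenerate simplex of which $f(x)$ is a degeneration. The Barratt nerve is $BX=N(X^\sharp)$, $B(f)=N(f^\sharp)$, where $N$ is the nerve. For an $n$-simplex $y$ of $X$ let $\bar y:\Delta[n]\to X$ be its representing map. A non-degenerate $n$-simplex $y$ is regular if the canonical map $\Delta[n]\sqcup_{\Delta[n-1]}Y'\to X$ is degreewise injective, where $Y'\subseteq X$ is the simplicial subset generated by the last face $y\delta_n$ and the pushout is taken along $\delta_n:\Delta[n-1]\to\Delta[n]$ and $\Delta[n-1]\to Y'$ (for $n=0$, $\Delta[-1]=Y'=\emptyset$, so the condition always holds); $X$ is regular if all its non-degenerate simplices are regular. A simplicial set is non-singular if the representing map of each of its non-degenerate simplices is degreewise injective; desingularization $D$ is the left adjoint of the inclusion of non-singular simplicial sets into all simplicial sets. Let $\varphi:P\to R$ be an order-preserving map of posets, and $i_0:P\to P\times[1]$, $p\mapsto(p,0)$,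 where $[1]=\{0<1\}$. The (backwards) topological mapping cylinder $T(N\varphi)$ is the pushout of $N(P\times[1])\xleftarrow{Ni_0}NP\xrightarrow{N\varphi}NR$ in simplicial sets. The (backwards) reduced mapping cylinder is $M(N\varphi)=N\bigl((P\times[1])\sqcup_P R\bigr)$, the nerve of the pushout of $P\times[1]\xleftarrow{i_0}P\xrightarrow{\varphi}R$ in posets. The canonical map $cr:T(N\varphi)\to M(N\varphi)$ is the one induced by the universal property of the pushout $T(N\varphi)$. As $M(N\varphi)$ is non-singular, it factors uniquely through the unit $T(N\varphi)\to DT(N\varphi)$ as a map $dcr:DT(N\varphi)\to M(N\varphi)$. Theorem. Let $X$ be a regular simplicial set. For each $n\ge 0$ and each $n$-simplex $y$ of $X$ (degenerate or not), the canonical map $$dcr:DT(B(\bar y))\to M(B(\bar y)),$$ taken for $\varphi=(\bar y)^\sharp:\Delta[n]^\sharp\to X^\sharp$, is an isomorphism. -/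

import Mathlib

open CategoryTheory CategoryTheory.Limits Simplicial Opposite

universe u

namespace SSet

section Regular

variable {X : SSet.{u}}

/-- The canonical map `Δ[n+1] ⊔_{Δ[n]} Y' ⟶ X` associated with an `(n+1)`-simplex `y` of `X`,
where `Y'` is the simplicial subset of `X` generated by the last face `y δ_{n+1}` of `y`, and where
the pushout is taken along the coface map `δ_{n+1} : Δ[n] ⟶ Δ[n+1]` and the corestricted
representing map `Δ[n] ⟶ Y'` of `y δ_{n+1}`. -/
noncomputable def lastFaceGluing {n : ℕ} (y : X _⦋n + 1⦌) :
    pushout (stdSimplex.{u}.δ (Fin.last (n + 1)))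
      (Subcomplex.toOfSimplex (X.δ (Fin.last (n + 1)) y)) ⟶ X :=
  pushout.desc (yonedaEquiv.symm y) (Subcomplex.ofSimplex (X.δ (Fin.last (n + 1)) y)).ι
    (yonedaEquiv.injective (by
      rw [Subcomplex.toOfSimplex_ι, yonedaEquiv_comp]
      simp only [Equiv.apply_symm_apply]
      rfl))

/-- A simplex is regular if the canonical map `lastFaceGluing` is degreewise injective.
In dimension `0`, the last face is empty and the condition reads: `Δ[0] ⟶ X` is
degreewise injective, which always holds. -/
def IsRegularSimplex {n : ℕ} (y : X _⦋n⦌) : Prop :=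
  match n, y with
  | 0, _ => True
  | _ + 1, y => Mono (lastFaceGluing y)

variable (X) in
/-- A simplicial set is regular if all its nondegenerate simplices are regular. -/
def IsRegular : Prop :=
  ∀ (n : ℕ) (y : X _⦋n⦌), y ∈ X.nonDegenerate n → IsRegularSimplex y

end Regular

section Sharp

variable {X Y : SSet.{u}}

lemma S.map_mono (f : X ⟶ Y) {s t : X.S} (h : s.subcomplex ≤ t.subcomplex) :
    (s.map f).subcomplex ≤ (t.map f).subcomplex := by
  have : s.subcomplex.image f ≤ t.subcomplex.image f := Subcomplex.image_monotone f h
  rwa [Subcomplex.image_ofSimplex, Subcomplex.image_ofSimplex] at this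

lemma S.map_subcomplex_congr (f : X ⟶ Y) {s t : X.S} (h : s.subcomplex = t.subcomplex) :
    (s.map f).subcomplex = (t.map f).subcomplex :=
  le_antisymm (S.map_mono f h.le) (S.map_mono f h.ge)

/-- The functor `X ↦ X♯` from simplicial sets to posets: `X♯` is the poset `X.N` of
nondegenerate simplices of `X`, ordered by the relation of being a face, and a simplicial map `f`
sends a nondegenerate simplex `x` to the nondegenerate simplex of which `f(x)` is a degeneration. -/
noncomputable def sharp : SSet.{u} ⥤ PartOrd.{u} where
  obj X := PartOrd.of X.N
  map {X Y} f := PartOrd.ofHom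
    { toFun := fun x ↦ (x.toS.map f).toN
      monotone' := fun x x' h ↦ by
        rw [N.le_iff, S.subcomplex_toN, S.subcomplex_toN]
        exact S.map_mono f h }
  map_id X := by
    ext x
    exact S.toN_eq_iff.2 rfl
  map_comp f g := by
    ext x
    refine S.toN_eq_iff.2 ((S.subcomplex_toN _).trans ?_)
    exact S.map_subcomplex_congr g (S.subcomplex_toN _)

/-- The Barratt nerve `B X = N (X♯)`. -/
noncomputable def barrattNerve : SSet.{u} ⥤ SSet.{u} := sharp ⋙ PartOrd.nerveFunctor

lemma barrattNerve_map (f : X ⟶ Y) :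
    barrattNerve.map f = PartOrd.nerveFunctor.map (sharp.map f) := rfl

end Sharp

section Desingularization

variable (X : SSet.{u})

/-- Two simplices of `X` of the same degree are identified if they have the same image under
every simplicial map from `X` to a nonsingular simplicial set. -/
def desingSetoid (k : SimplexCategoryᵒᵖ) : Setoid (X.obj k) where
  r x x' := ∀ (Z : SSet.{u}), Z.Nonsingular → ∀ f : X ⟶ Z, f.app k x = f.app k x'
  iseqv :=
    { refl := fun _ _ _ _ ↦ rfl
      symm := fun h Z hZ f ↦ (h Z hZ f).symm
      trans := fun h h' Z hZ f ↦ (h Z hZ f).trans (h' Z hZ f) }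

/-- The desingularization `D X` of `X`: the image of `X` in the product of the nonsingular
simplicial sets that it maps to, that is, its largest nonsingular quotient. -/
def desing : SSet.{u} where
  obj k := Quotient (desingSetoid X k)
  map {k l} α := ↾(Quotient.map (X.map α) (fun x x' h Z hZ f ↦ by
    rw [NatTrans.naturality_apply f α x, NatTrans.naturality_apply f α x', h Z hZ f]))
  map_id k := by
    ext x
    induction x using Quotient.inductionOn
    simp
  map_comp α β := by
    ext x
    induction x using Quotient.inductionOn with
    | _ x => exact congrArg (Quotient.mk _) (Functor.map_comp_apply X α β x)

/-- The quotient map `X ⟶ D X`. -/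
def desingUnit : X ⟶ desing X where
  app k := ↾(fun x ↦ Quotient.mk (desingSetoid X k) x)
  naturality _ _ _ := rfl

variable {X}

/-- The map `D X ⟶ Z` induced by a map from `X` to a nonsingular simplicial set `Z`. -/
def desingDesc {Z : SSet.{u}} [hZ : Z.Nonsingular] (f : X ⟶ Z) : desing X ⟶ Z where
  app k := ↾(Quotient.lift (f.app k) (fun _ _ h ↦ h Z hZ f))
  naturality k l α := by
    ext x
    induction x using Quotient.inductionOn with
    | _ x => exact NatTrans.naturality_apply f α x

lemma desingUnit_desingDesc {Z : SSet.{u}} [Z.Nonsingular] (f : X ⟶ Z) :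
    desingUnit X ≫ desingDesc f = f := rfl

/-- The induced map `D X ⟶ Z` is the only one that is compatible with `X ⟶ D X`. -/
lemma desing_hom_ext {Z : SSet.{u}} {g g' : desing X ⟶ Z}
    (h : desingUnit X ≫ g = desingUnit X ≫ g') : g = g' := by
  ext k x
  induction x using Quotient.inductionOn with
  | _ x => exact ConcreteCategory.congr_hom (NatTrans.congr_app h k) x

/-- A simplex of a nonsingular simplicial set with two equal vertices `i < j` is unchanged
under the operator that replaces `i + 1` by `i`. -/
lemma Nonsingular.map_δ_σ_eq {Z : SSet.{u}} [Z.Nonsingular] {n : ℕ} (z : Z _⦋n + 1⦌)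
    (i : Fin (n + 1)) (j : Fin (n + 2)) (hij : i.castSucc < j)
    (h : Z.map (SimplexCategory.const ⦋0⦌ ⦋n + 1⦌ i.castSucc).op z =
      Z.map (SimplexCategory.const ⦋0⦌ ⦋n + 1⦌ j).op z) :
    Z.map (SimplexCategory.σ i ≫ SimplexCategory.δ i.succ).op z = z := by
  obtain ⟨m, ρ, _, ⟨w, hw⟩, rfl⟩ := Z.exists_nonDegenerate z
  rw [← Functor.map_comp_apply, ← Functor.map_comp_apply, ← op_comp, ← op_comp] at h
  have h' := Nonsingular.injective_map w hw h
  have h0 : ρ i.castSucc = ρ j := by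
    have := congrArg (fun (t : ⦋0⦌ ⟶ ⦋m⦌) ↦ t 0) h'
    exact this
  have hmono : Monotone ρ := ρ.toOrderHom.monotone
  have h1 : ρ i.castSucc = ρ i.succ :=
    le_antisymm (hmono i.castSucc_lt_succ.le) (h0 ▸ hmono (Fin.castSucc_lt_iff_succ_le.1 hij))
  have h2 : (SimplexCategory.σ i ≫ SimplexCategory.δ i.succ) ≫ ρ = ρ := by
    ext l : 3
    change ρ (i.succ.succAbove (i.predAbove l)) = ρ l
    by_cases hl : l = i.succ
    · subst hl
      rw [Fin.predAbove_succ_self, Fin.succAbove_succ_self]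
      exact h1
    · congr 1
      have hl' : l.val ≠ i.val + 1 := fun e ↦ hl (Fin.ext e)
      apply Fin.ext
      rcases lt_or_ge i.castSucc l with h3 | h3
      · have h4 : i.val < l.val := h3
        rw [Fin.predAbove_of_castSucc_lt _ _ h3, Fin.succAbove_of_lt_succ, Fin.succ_pred]
        rw [Fin.succ_pred, Fin.lt_def, Fin.val_succ]
        lia
      · have h4 : l.val ≤ i.val := h3
        rw [Fin.predAbove_of_le_castSucc _ _ h3, Fin.succAbove_of_castSucc_lt, Fin.castSucc_castPred]
        rw [Fin.castSucc_castPred, Fin.lt_def, Fin.val_succ]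
        lia
  rw [← Functor.map_comp_apply, ← op_comp, h2]

instance : (desing X).Nonsingular where
  mono := by
    intro n ⟨x, hx⟩
    simp only [NatTrans.mono_iff_mono_app, mono_iff_injective]
    intro ⟨⟨k⟩⟩ a b hab
    obtain ⟨α, rfl⟩ := stdSimplex.objEquiv.symm.surjective a
    obtain ⟨β, rfl⟩ := stdSimplex.objEquiv.symm.surjective b
    have hab' : (desing X).map α.op x = (desing X).map β.op x := hab
    by_contra hne
    have : ∃ l : Fin (k + 1), α l ≠ β l := by
      by_contra! H
      exact hne (by congr 1; ext l : 3; exact H l)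
    obtain ⟨l, hl⟩ := this
    have hv : (desing X).map (SimplexCategory.const ⦋0⦌ ⦋n⦌ (α l)).op x =
        (desing X).map (SimplexCategory.const ⦋0⦌ ⦋n⦌ (β l)).op x := by
      have := congrArg ((desing X).map (SimplexCategory.const ⦋0⦌ ⦋k⦌ l).op) hab'
      rw [← Functor.map_comp_apply, ← Functor.map_comp_apply, ← op_comp, ← op_comp] at this
      exact this
    clear hab hab' hne
    wlog hlt : α l < β l generalizing α β
    · exact this (α := β) (β := α) hl.symm hv.symm (lt_of_le_of_ne (not_lt.1 hlt) hl.symm)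
    obtain _ | n := n
    · exact hl (Subsingleton.elim (α := Fin 1) _ _)
    obtain ⟨i, hi⟩ := Fin.exists_castSucc_eq.2 (hlt.trans_le (Fin.le_last _)).ne
    have key : (desing X).map (SimplexCategory.σ i ≫ SimplexCategory.δ i.succ).op x = x := by
      clear hx
      induction x using Quotient.inductionOn with
      | _ x =>
        refine Quotient.sound fun Z hZ f ↦ ?_
        have hv' := Quotient.exact hv Z hZ f
        rw [NatTrans.naturality_apply f, NatTrans.naturality_apply f] at hv'
        rw [NatTrans.naturality_apply f]
        rw [← hi] at hv' hlt
        exact Nonsingular.map_δ_σ_eq (f.app _ x) i (β l) hlt hv'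
    refine hx ?_
    rw [← key, op_comp, Functor.map_comp_apply]
    exact (desing X).σ_mem_degenerate i _

/-- The full subcategory of nonsingular simplicial sets. -/
abbrev NsSet := ObjectProperty.FullSubcategory (fun Z : SSet.{u} ↦ Z.Nonsingular)

/-- Desingularization is left adjoint to the inclusion of nonsingular simplicial sets. -/
noncomputable instance : Reflective (ObjectProperty.ι (fun Z : SSet.{u} ↦ Z.Nonsingular))  where
  L := Adjunction.leftAdjointOfEquiv (F_obj := fun X ↦ ⟨desing X, inferInstance⟩)
    (fun X Z ↦
      { toFun := fun g ↦ desingUnit X ≫ g.hom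
        invFun := fun f ↦ ObjectProperty.homMk (@desingDesc X Z.obj Z.property f)
        left_inv := fun g ↦ by ext : 1; exact desing_hom_ext rfl
        right_inv := fun f ↦ rfl })
    (fun _ _ _ _ _ ↦ rfl)
  adj := Adjunction.adjunctionOfEquivLeft _ _

end Desingularization

section MappingCylinder

variable {P Q R : PartOrd.{u}}


/-- The preorder relation on the disjoint union of `Q` and `R` that is generated by the orders of
`Q` and `R` and by `f p ∼ g p` for all `p`. -/
inductive GlueRel (f : P ⟶ Q) (g : P ⟶ R) : Q ⊕ R → Q ⊕ R → Prop where
  /-- the order of `Q` -/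
  | inl {a b : Q} (h : a ≤ b) : GlueRel f g (Sum.inl a) (Sum.inl b)
  /-- the order of `R` -/
  | inr {a b : R} (h : a ≤ b) : GlueRel f g (Sum.inr a) (Sum.inr b)
  /-- the gluing relation, in one direction -/
  | glue (p : P) : GlueRel f g (Sum.inl (f p)) (Sum.inr (g p))
  /-- the gluing relation, in the other direction -/
  | glue' (p : P) : GlueRel f g (Sum.inr (g p)) (Sum.inl (f p))
  /-- transitivity -/
  | trans {a b c : Q ⊕ R} (h : GlueRel f g a b) (h' : GlueRel f g b c) : GlueRel f g a c

/-- The disjoint union of `Q` and `R`, preordered by `GlueRel`. -/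
@[nolint unusedArguments]
def Glue (_ : P ⟶ Q) (_ : P ⟶ R) : Type u := Q ⊕ R

instance (f : P ⟶ Q) (g : P ⟶ R) : Preorder (Glue f g) where
  le := GlueRel f g
  le_refl a := by
    cases a with
    | inl a => exact .inl le_rfl
    | inr a => exact .inr le_rfl
  le_trans _ _ _ := .trans

/-- The pushout `Q ⊔_P R` in the category of posets: the poset associated with the preorder
`GlueRel` on the disjoint union. -/
def posetPushout (f : P ⟶ Q) (g : P ⟶ R) : PartOrd.{u} :=
  PartOrd.of (Antisymmetrization (Glue f g) (· ≤ ·))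

/-- The canonical map `Q ⟶ Q ⊔_P R`. -/
def posetPushoutInl (f : P ⟶ Q) (g : P ⟶ R) : Q ⟶ posetPushout f g :=
  PartOrd.ofHom
    { toFun := fun q ↦ toAntisymmetrization (α := Glue f g) (· ≤ ·) (Sum.inl q)
      monotone' := fun _ _ h ↦ GlueRel.inl h }

/-- The canonical map `R ⟶ Q ⊔_P R`. -/
def posetPushoutInr (f : P ⟶ Q) (g : P ⟶ R) : R ⟶ posetPushout f g :=
  PartOrd.ofHom
    { toFun := fun r ↦ toAntisymmetrization (α := Glue f g) (· ≤ ·) (Sum.inr r)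
      monotone' := fun _ _ h ↦ GlueRel.inr h }

lemma posetPushout_condition (f : P ⟶ Q) (g : P ⟶ R) :
    f ≫ posetPushoutInl f g = g ≫ posetPushoutInr f g := by
  ext p
  exact Quotient.sound ⟨GlueRel.glue p, GlueRel.glue' p⟩

lemma GlueRel.desc_le {f : P ⟶ Q} {g : P ⟶ R} {S : PartOrd.{u}} {h : Q ⟶ S} {k : R ⟶ S}
    (w : f ≫ h = g ≫ k) {a b : Q ⊕ R} (hab : GlueRel f g a b) :
    Sum.elim h k a ≤ Sum.elim h k b := by
  induction hab with
  | inl hab => exact h.hom.monotone hab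
  | inr hab => exact k.hom.monotone hab
  | glue p => exact (ConcreteCategory.congr_hom w p).le
  | glue' p => exact (ConcreteCategory.congr_hom w p).ge
  | trans _ _ h₁ h₂ => exact h₁.trans h₂

/-- The map out of `Q ⊔_P R` induced by compatible maps out of `Q` and `R`. -/
def posetPushoutDesc (f : P ⟶ Q) (g : P ⟶ R) {S : PartOrd.{u}} (h : Q ⟶ S) (k : R ⟶ S)
    (w : f ≫ h = g ≫ k) : posetPushout f g →o S where
  toFun := Quotient.lift (Sum.elim h k) (fun _ _ hab ↦
    le_antisymm (GlueRel.desc_le w hab.1) (GlueRel.desc_le w hab.2))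
  monotone' a b hab := by
    induction a using Quotient.inductionOn
    induction b using Quotient.inductionOn
    exact GlueRel.desc_le w hab

lemma posetPushout_isPushout (f : P ⟶ Q) (g : P ⟶ R) :
    IsPushout f g (posetPushoutInl f g) (posetPushoutInr f g) := by
  refine ⟨⟨posetPushout_condition f g⟩, ⟨PushoutCocone.IsColimit.mk _
    (fun s ↦ PartOrd.ofHom (posetPushoutDesc f g s.inl s.inr s.condition)) ?_ ?_ ?_⟩⟩
  · intro s
    rfl
  · intro s
    rfl
  · intro s m h₁ h₂
    ext x
    induction x using Quotient.inductionOn with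
    | _ x =>
      cases x with
      | inl q => exact ConcreteCategory.congr_hom h₁ q
      | inr r => exact ConcreteCategory.congr_hom h₂ r

/-- The poset `P × [1]`. -/
def cylinder (P : PartOrd.{u}) : PartOrd.{u} := PartOrd.of (P × Fin 2)

/-- The map `i₀ : P ⟶ P × [1]`, `p ↦ (p, 0)`. -/
def cylinderZero (P : PartOrd.{u}) : P ⟶ cylinder P :=
  PartOrd.ofHom
    { toFun := fun p ↦ ((p, 0) : P × Fin 2)
      monotone' := fun _ _ h ↦ Prod.mk_le_mk.2 ⟨h, le_rfl⟩ }

/-- The (backwards) topological mapping cylinder `T(Nφ)` of the nerve of `φ : P ⟶ R`, that is,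
the pushout of `N(P × [1]) ⟵ NP ⟶ NR` in simplicial sets. -/
noncomputable def topCylinder (φ : P ⟶ R) : SSet.{u} :=
  pushout (PartOrd.nerveFunctor.map (cylinderZero P)) (PartOrd.nerveFunctor.map φ)

/-- The (backwards) reduced mapping cylinder `M(Nφ)` of the nerve of `φ : P ⟶ R`, that is,
the nerve of the pushout of `P × [1] ⟵ P ⟶ R` in posets. -/
def redCylinder (φ : P ⟶ R) : SSet.{u} :=
  PartOrd.nerveFunctor.obj (posetPushout (cylinderZero P) φ)

instance (φ : P ⟶ R) : (redCylinder φ).Nonsingular :=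
  inferInstanceAs (nerve (posetPushout (cylinderZero P) φ)).Nonsingular

/-- The cylinder reduction map `cr : T(Nφ) ⟶ M(Nφ)`. -/
noncomputable def cr (φ : P ⟶ R) : topCylinder φ ⟶ redCylinder φ :=
  pushout.desc
    (PartOrd.nerveFunctor.map (posetPushoutInl (cylinderZero P) φ))
    (PartOrd.nerveFunctor.map (posetPushoutInr (cylinderZero P) φ))
    (((PartOrd.nerveFunctor.map_comp _ _).symm.trans
      (congrArg PartOrd.nerveFunctor.map (posetPushout_condition (cylinderZero P) φ))).trans
        (PartOrd.nerveFunctor.map_comp _ _))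

/-- The canonical map `dcr : D T(Nφ) ⟶ M(Nφ)`, through which `cr` factors. For a simplicial map
`f` and `φ = f♯`, the map `Nφ` is `B f`, so that this is the map `dcr : D T(B f) ⟶ M(B f)`. -/
noncomputable def dcr (φ : P ⟶ R) : desing (topCylinder φ) ⟶ redCylinder φ :=
  desingDesc (cr φ)

end MappingCylinder

end SSet

/-! The map `dcr` is bijective in each degree as soon as `φ : P ⟶ R` has two properties. Lifting:
every `r ≤ φ p` is `φ p'` for some `p' ≤ p`. Joining: two elements under `p` with the same image
have a common upper bound under `p` with that image. Lifting makes `cr` surjective: a chain of the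
reduced cylinder ending in `P × {1}` lifts to `P × [1]` from its last element downwards, and one
ending in `R` stays in `R` (`cr_app_surjective`). Joining gives injectivity. Chains of `P × [1]`
with equal image in the reduced cylinder can differ only at level 0, by elements with equal image in
`R`. Working down from the top, both differing elements are raised to a common bound. No map to a
nonsingular simplicial set detects this, since there faces of one simplex with equal vertices
coincide (`Nonsingular.map_eq_map`, `app_nerveChain_cylinder_eq`). For `φ = f♯`, lifting holds for
every simplicial map `f`. Joining is where regularity enters: faces of a simplex with the same
nondegenerate part are closed under union (`IsRegular.map_mem_ofSimplex`). The source of `f` need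
not be a standard simplex. -/

namespace SSet

/-! ### Regular simplices -/

/-- The gluing identifies only simplices inside the last face, and `α` lies outside it because it
hits the last vertex. -/
lemma IsRegularSimplex.eq_of_map_eq {X : SSet.{u}} {n k : ℕ} {y : X _⦋n + 1⦌}
    (hy : IsRegularSimplex y) {α β : ⦋k⦌ ⟶ ⦋n + 1⦌} {l : Fin (k + 1)}
    (hα : α l = Fin.last (n + 1)) (h : X.map α.op y = X.map β.op y) : α = β := by
  have hmono : Mono (lastFaceGluing y) := hy
  set f := stdSimplex.{u}.δ (Fin.last (n + 1))
  set g := Subcomplex.toOfSimplex (X.δ (Fin.last (n + 1)) y)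
  have hinl : pushout.inl f g ≫ lastFaceGluing y = yonedaEquiv.symm y :=
    pushout.inl_desc _ _ _
  let a := stdSimplex.objEquiv.{u}.symm α
  let b := stdSimplex.objEquiv.{u}.symm β
  have hab : (pushout.inl f g).app (op ⦋k⦌) a = (pushout.inl f g).app (op ⦋k⦌) b := by
    have hinj := (mono_iff_injective _).1
      ((NatTrans.mono_iff_mono_app (lastFaceGluing y)).1 hmono (op ⦋k⦌))
    apply hinj
    have key : ∀ c, (lastFaceGluing y).app (op ⦋k⦌) ((pushout.inl f g).app (op ⦋k⦌) c) =
        (yonedaEquiv.symm y).app _ c :=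
      fun c ↦ ConcreteCategory.congr_hom (NatTrans.congr_app hinl (op ⦋k⦌)) c
    rw [key, key]
    exact h
  have hp := (IsPushout.of_hasPushout f g).map ((evaluation _ _).obj (op ⦋k⦌))
  have ha : a ∉ Set.range (f.app (op ⦋k⦌)) := by
    rintro ⟨c, hc⟩
    obtain ⟨γ, rfl⟩ := stdSimplex.objEquiv.symm.surjective c
    have h1 : γ ≫ SimplexCategory.δ (Fin.last (n + 1)) = α :=
      stdSimplex.objEquiv.{u}.symm.injective hc
    have h2 : (Fin.last (n + 1)).succAbove (γ l) = Fin.last (n + 1) :=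
      (congrArg (fun t : ⦋k⦌ ⟶ ⦋n + 1⦌ ↦ t l) h1).trans hα
    exact Fin.succAbove_ne _ _ h2
  classical
  -- Collapsing the last face to `none` is compatible with the constant map `none` on `Y'`, so `r`
  -- extends to the pushout and separates `a` from all other simplices.
  let r : (Δ[n + 1] : SSet.{u}).obj (op ⦋k⦌) ⟶ Option ((Δ[n + 1] : SSet.{u}).obj (op ⦋k⦌)) :=
    ↾(fun c ↦ if c ∈ Set.range (f.app (op ⦋k⦌)) then none else some c)
  let d := hp.desc r (↾(fun _ ↦ none)) (ConcreteCategory.hom_ext _ _ fun c ↦ if_pos ⟨c, rfl⟩)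
  have hd : ∀ c, d ((pushout.inl f g).app (op ⦋k⦌) c) = r c :=
    fun c ↦ ConcreteCategory.congr_hom (hp.inl_desc _ _ _) c
  have h3 : r a = r b := by rw [← hd, ← hd, hab]
  have h4 : r a = some a := if_neg ha
  have h5 : a = b := by
    by_cases hb : b ∈ Set.range (f.app (op ⦋k⦌))
    · have : r b = none := if_pos hb
      rw [h4, this] at h3
      cases h3
    · have : r b = some b := if_neg hb
      rw [h4, this] at h3
      exact Option.some.inj h3
  exact stdSimplex.objEquiv.symm.injective h5

end SSet

/-! ### Operators and their sets of vertices -/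

namespace SimplexCategory

/-- `β` need not be injective: any section of `β` over the vertices of `α` is monotone there,
because `β` is monotone. -/
lemma exists_comp_eq_of_range_subset {k m n : ℕ} (α : ⦋k⦌ ⟶ ⦋n⦌) (β : ⦋m⦌ ⟶ ⦋n⦌)
    (h : ∀ l, ∃ i, β i = α l) : ∃ θ : ⦋k⦌ ⟶ ⦋m⦌, θ ≫ β = α := by
  have : ∃ s : Fin (n + 1) → Fin (m + 1), ∀ l, β (s (α l)) = α l := by
    classical
    refine ⟨fun x ↦ if hx : ∃ i, β i = x then hx.choose else 0, fun l ↦ ?_⟩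
    simp only [dif_pos (h l)]
    exact (h l).choose_spec
  obtain ⟨s, hs⟩ := this
  have hmono : Monotone (fun l ↦ s (α l)) := by
    intro l l' hl
    by_contra! hlt
    have h1 : α l ≤ α l' := α.toOrderHom.monotone hl
    have h2 : β (s (α l')) ≤ β (s (α l)) := β.toOrderHom.monotone hlt.le
    rw [hs, hs] at h2
    have h3 : α l = α l' := le_antisymm h1 h2
    simp only [h3, lt_self_iff_false] at hlt
  refine ⟨SimplexCategory.Hom.mk ⟨_, hmono⟩, ?_⟩
  ext l : 3
  exact hs l

lemma exists_hom_of_nonempty {n : ℕ} (s : Finset (Fin (n + 1))) (hs : s.Nonempty) :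
    ∃ (c : ℕ) (γ : ⦋c⦌ ⟶ ⦋n⦌), ∀ x, x ∈ s ↔ ∃ i, γ i = x := by
  obtain ⟨c, hc⟩ := Nat.exists_eq_succ_of_ne_zero hs.card_pos.ne'
  refine ⟨c, SimplexCategory.Hom.mk (s.orderEmbOfFin hc).toOrderHom, fun x ↦ ?_⟩
  have := s.range_orderEmbOfFin hc
  rw [← Finset.mem_coe, ← this]
  rfl

end SimplexCategory

/-! ### Unions of faces in a regular simplicial set -/

namespace SSet

/-- In a regular simplicial set, faces of a simplex with the same nondegenerate part as a given
face are closed under unions. -/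
lemma IsRegular.map_mem_ofSimplex {X : SSet.{u}} (hX : X.IsRegular) {n : ℕ} (y : X _⦋n⦌)
    {a b c : ℕ} (α : ⦋a⦌ ⟶ ⦋n⦌) (β : ⦋b⦌ ⟶ ⦋n⦌) (γ : ⦋c⦌ ⟶ ⦋n⦌)
    (h : Subcomplex.ofSimplex (X.map α.op y) = Subcomplex.ofSimplex (X.map β.op y))
    (hγ : ∀ l, (∃ i, α i = γ l) ∨ ∃ i, β i = γ l) :
    X.map γ.op y ∈ (Subcomplex.ofSimplex (X.map α.op y)).obj _ := by
  -- The last face of a nondegenerate simplex may be degenerate, so the induction on dimension runs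
  -- over all `y`.
  induction n using Nat.strong_induction_on with
  | _ n ih =>
  have mem_of_subset : ∀ {m : ℕ} (μ : ⦋m⦌ ⟶ ⦋n⦌), (∀ l, ∃ i, μ i = γ l) →
      X.map γ.op y ∈ (Subcomplex.ofSimplex (X.map μ.op y)).obj _ := by
    intro m μ hμ
    obtain ⟨θ, rfl⟩ := SimplexCategory.exists_comp_eq_of_range_subset γ μ hμ
    rw [Subcomplex.mem_ofSimplex_obj_iff]
    exact ⟨θ, by rw [← Functor.map_comp_apply, ← op_comp]⟩
  by_cases hy : y ∈ X.nonDegenerate n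
  · obtain _ | n := n
    · exact mem_of_subset α fun l ↦ ⟨0, Subsingleton.elim (α := Fin 1) _ _⟩
    · have hreg : IsRegularSimplex y := hX _ y hy
      -- If one of `α`, `β` hits the last vertex, regularity makes each factor through the other, so
      -- they have the same vertices and `γ` adds none.
      have factor : ∀ {a b : ℕ} (α : ⦋a⦌ ⟶ ⦋n + 1⦌) (β : ⦋b⦌ ⟶ ⦋n + 1⦌) {l : Fin (a + 1)},
          α l = Fin.last (n + 1) →
          Subcomplex.ofSimplex (X.map α.op y) ≤ Subcomplex.ofSimplex (X.map β.op y) →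
          ∃ θ, α = θ ≫ β := by
        intro a b α β l hl hle
        obtain ⟨θ, hθ⟩ := (Subcomplex.mem_ofSimplex_obj_iff _ _).1
          ((Subcomplex.ofSimplex_le_iff _ _).1 hle)
        rw [← Functor.map_comp_apply, ← op_comp] at hθ
        exact ⟨θ, hreg.eq_of_map_eq hl hθ.symm⟩
      by_cases hα : ∃ l, α l = Fin.last (n + 1)
      · obtain ⟨l, hl⟩ := hα
        obtain ⟨θ, hθ⟩ := factor α β hl h.le
        have hβl : β (θ l) = Fin.last (n + 1) := by
          rw [← hl, hθ]
          rfl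
        obtain ⟨θ', hθ'⟩ := factor β α hβl h.ge
        refine mem_of_subset α fun l ↦ ?_
        obtain hi | ⟨i, hi⟩ := hγ l
        · exact hi
        · refine ⟨θ' i, ?_⟩
          rw [← hi, hθ']
          rfl
      by_cases hβ : ∃ l, β l = Fin.last (n + 1)
      · obtain ⟨l, hl⟩ := hβ
        obtain ⟨θ, hθ⟩ := factor β α hl h.ge
        refine absurd ⟨θ l, ?_⟩ hα
        rw [← hl, hθ]
        rfl
      -- If neither does, all three operators factor through the last face, which has smaller
      -- dimension.
      · have through : ∀ {a : ℕ} (α : ⦋a⦌ ⟶ ⦋n + 1⦌), (∀ l, α l ≠ Fin.last (n + 1)) →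
            ∃ α', α' ≫ SimplexCategory.δ (Fin.last (n + 1)) = α := by
          intro a α hα
          refine SimplexCategory.exists_comp_eq_of_range_subset _ _ fun l ↦ ?_
          exact Fin.exists_succAbove_eq (hα l)
        push Not at hα hβ
        obtain ⟨α', rfl⟩ := through α hα
        obtain ⟨β', rfl⟩ := through β hβ
        obtain ⟨γ', rfl⟩ := through γ (fun l e ↦ by
          obtain ⟨i, hi⟩ | ⟨i, hi⟩ := hγ l
          · exact hα i (hi.trans e)
          · exact hβ i (hi.trans e))
        simp only [op_comp, Functor.map_comp_apply] at h ⊢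
        refine ih n (Nat.lt_succ_self n) _ α' β' γ' h fun l ↦ ?_
        exact (hγ l).imp (fun ⟨i, hi⟩ ↦ ⟨i, Fin.succAbove_right_injective hi⟩)
          (fun ⟨i, hi⟩ ↦ ⟨i, Fin.succAbove_right_injective hi⟩)
  -- A degenerate `y` is replaced by the lower-dimensional `z`; composing with `ρ` preserves the
  -- inclusion of vertex sets.
  · obtain ⟨m, hm, ρ, z, rfl⟩ := (X.mem_degenerate_iff_notMem_nonDegenerate y).2 hy
    simp only [← Functor.map_comp_apply, ← op_comp] at h ⊢
    refine ih m hm z (α ≫ ρ) (β ≫ ρ) (γ ≫ ρ) h fun l ↦ ?_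
    exact (hγ l).imp (fun ⟨i, hi⟩ ↦ ⟨i, congrArg ρ hi⟩) (fun ⟨i, hi⟩ ↦ ⟨i, congrArg ρ hi⟩)

/-! ### The lifting and joining properties of `f♯` -/

section Sharp

variable {W X : SSet.{u}} (f : W ⟶ X)

lemma sharp_map_eq_iff (p : W.N) (r : X.N) :
    sharp.map f p = r ↔ (p.toS.map f).subcomplex = r.subcomplex :=
  S.toN_eq_iff.trans eq_comm

lemma subcomplex_sharp_map (p : W.N) :
    (sharp.map f p : X.N).subcomplex = (p.toS.map f).subcomplex :=
  S.subcomplex_toN _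

/-- Faces of `f♯ p` lift to faces of `p`. -/
lemma exists_le_sharp_map_eq (p : W.N) (r : X.N) (h : r ≤ (sharp.map f p : X.N)) :
    ∃ p' ≤ p, sharp.map f p' = r := by
  replace h := N.le_iff.1 h
  rw [subcomplex_sharp_map, Subcomplex.ofSimplex_le_iff, Subcomplex.mem_ofSimplex_obj_iff] at h
  obtain ⟨α, hα⟩ := h
  -- As `f` commutes with `α`, it sends this face of `p` to `r`; the nondegenerate part of the face
  -- is the lift.
  refine ⟨(S.mk (W.map α.op p.simplex)).toN, ?_, ?_⟩
  · rw [N.le_iff, S.subcomplex_toN]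
    exact Subcomplex.ofSimplex_map_le α p.simplex
  · rw [sharp_map_eq_iff]
    refine (S.map_subcomplex_congr f (S.subcomplex_toN _)).trans ?_
    exact congrArg Subcomplex.ofSimplex ((NatTrans.naturality_apply f _ _).trans hα)

/-- If `X` is regular, two faces of `p` with the same image under `f♯` are contained in a common
face of `p` with that image. -/
lemma IsRegular.exists_le_sharp_map_eq (hX : X.IsRegular) (p p₁ p₂ : W.N) (h₁ : p₁ ≤ p)
    (h₂ : p₂ ≤ p) (h : sharp.map f p₁ = sharp.map f p₂) :
    ∃ m ≤ p, p₁ ≤ m ∧ p₂ ≤ m ∧ sharp.map f m = sharp.map f p₁ := by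
  rw [N.le_iff, Subcomplex.ofSimplex_le_iff, Subcomplex.mem_ofSimplex_obj_iff] at h₁ h₂
  obtain ⟨α, hα⟩ := h₁
  obtain ⟨β, hβ⟩ := h₂
  have h' : (p₁.toS.map f).subcomplex = (p₂.toS.map f).subcomplex := by
    rw [← subcomplex_sharp_map, ← subcomplex_sharp_map, h]
  have hα' : X.map α.op (f.app _ p.simplex) = (p₁.toS.map f).simplex := by
    rw [← NatTrans.naturality_apply f]
    exact congrArg _ hα
  have hβ' : X.map β.op (f.app _ p.simplex) = (p₂.toS.map f).simplex := by
    rw [← NatTrans.naturality_apply f]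
    exact congrArg _ hβ
  classical
  -- `γ` spans the union of the vertex sets of `α` and `β`; the bound `m` is the nondegenerate part
  -- of the corresponding face of `p`.
  obtain ⟨c, γ, hγ⟩ := SimplexCategory.exists_hom_of_nonempty
    (Finset.univ.filter fun x ↦ (∃ i, α i = x) ∨ ∃ i, β i = x) ⟨α 0, by simp⟩
  simp only [Finset.mem_filter, Finset.mem_univ, true_and] at hγ
  obtain ⟨θ₁, hθ₁⟩ := SimplexCategory.exists_comp_eq_of_range_subset α γ
    fun l ↦ (hγ _).1 (Or.inl ⟨l, rfl⟩)
  obtain ⟨θ₂, hθ₂⟩ := SimplexCategory.exists_comp_eq_of_range_subset β γ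
    fun l ↦ (hγ _).1 (Or.inr ⟨l, rfl⟩)
  have hm₁ : p₁ ≤ (S.mk (W.map γ.op p.simplex)).toN := by
    rw [N.le_iff, S.subcomplex_toN, Subcomplex.ofSimplex_le_iff,
      Subcomplex.mem_ofSimplex_obj_iff]
    refine ⟨θ₁, ?_⟩
    rw [← Functor.map_comp_apply, ← op_comp, hθ₁]
    exact hα
  refine ⟨(S.mk (W.map γ.op p.simplex)).toN, ?_, hm₁, ?_, ?_⟩
  · rw [N.le_iff, S.subcomplex_toN]
    exact Subcomplex.ofSimplex_map_le γ p.simplex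
  · rw [N.le_iff, S.subcomplex_toN, Subcomplex.ofSimplex_le_iff,
      Subcomplex.mem_ofSimplex_obj_iff]
    refine ⟨θ₂, ?_⟩
    rw [← Functor.map_comp_apply, ← op_comp, hθ₂]
    exact hβ
  · refine le_antisymm ?_ ((sharp.map f).hom.monotone hm₁)
    refine (N.le_iff (x := sharp.map f _)).2 ?_
    rw [subcomplex_sharp_map, subcomplex_sharp_map]
    refine (S.map_subcomplex_congr f (S.subcomplex_toN _)).trans_le ?_
    change Subcomplex.ofSimplex (f.app _ (W.map γ.op p.simplex)) ≤ _
    rw [NatTrans.naturality_apply f, Subcomplex.ofSimplex_le_iff]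
    have := hX.map_mem_ofSimplex (f.app _ p.simplex) α β γ
      (by rw [hα', hβ']; exact h') fun l ↦ (hγ _).2 ⟨l, rfl⟩
    rwa [hα'] at this

end Sharp

/-! ### Simplices of nerves as chains -/

section Chain

variable {Q Q' : PartOrd.{u}}

/-- The simplex of the nerve of a poset given by a chain. -/
def nerveChain {k : ℕ} (c : Fin (k + 1) →o Q) : (PartOrd.nerveFunctor.obj Q) _⦋k⦌ :=
  c.monotone.functor

lemma nerveChain_surjective {k : ℕ} (x : (PartOrd.nerveFunctor.obj Q) _⦋k⦌) :
    ∃ c : Fin (k + 1) →o Q, nerveChain c = x :=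
  ⟨⟨(show ComposableArrows Q k from x).obj,
    (show ComposableArrows Q k from x).monotone⟩, nerve.ext_of_isThin (C := Q) rfl⟩

lemma nerveChain_injective {k : ℕ} {c c' : Fin (k + 1) →o Q}
    (h : nerveChain c = nerveChain c') : c = c' := by
  ext i
  exact congrArg (fun F : ComposableArrows Q k ↦ F.obj i) h

lemma map_nerveChain {k m : ℕ} (α : ⦋m⦌ ⟶ ⦋k⦌) (c : Fin (k + 1) →o Q) :
    (PartOrd.nerveFunctor.obj Q).map α.op (nerveChain c) =
      nerveChain (c.comp α.toOrderHom) :=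
  rfl

/-- A chain lifts along an order-preserving map with the downward lifting property as soon as its
last element does. -/
lemma exists_chain_lift (g : Q ⟶ Q') (hg : ∀ b x, x ≤ g b → ∃ a ≤ b, g a = x) {k : ℕ}
    (m : Fin (k + 1) →o Q') (b : Q) (hb : g b = m (Fin.last k)) :
    ∃ c : Fin (k + 1) →o Q, g.hom.comp c = m := by
  induction k with
  | zero =>
    refine ⟨⟨fun _ ↦ b, fun _ _ _ ↦ le_rfl⟩, ?_⟩
    ext i
    obtain rfl := Subsingleton.elim (α := Fin 1) i (Fin.last 0)
    exact hb
  | succ k ih =>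
    -- The tail is lifted before the first element, since `g` lifts only downwards.
    obtain ⟨c, hc⟩ := ih (m.comp ⟨Fin.succ, Fin.strictMono_succ.monotone⟩) hb
    have hc' : ∀ i, g (c i) = m i.succ := fun i ↦ DFunLike.congr_fun hc i
    obtain ⟨a, ha, ha'⟩ := hg (c 0) (m 0) (by
      rw [hc']
      exact m.monotone (Fin.zero_le _))
    refine ⟨⟨Fin.cons a c, ?_⟩, ?_⟩
    · refine Fin.monotone_iff_le_succ.2 fun i ↦ ?_
      induction i using Fin.cases with
      | zero => exact ha
      | succ i => exact c.monotone (Fin.castSucc_lt_succ (i := i)).le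
    · ext i
      induction i using Fin.cases with
      | zero => exact ha'
      | succ i => exact hc' i

end Chain

/-! ### Vertices of simplices in nonsingular simplicial sets -/

/-- Faces of a simplex of a nonsingular simplicial set with the same vertices are equal. -/
lemma Nonsingular.map_eq_map {Z : SSet.{u}} [Z.Nonsingular] {n k : ℕ} (z : Z _⦋n⦌)
    (α β : ⦋k⦌ ⟶ ⦋n⦌)
    (h : ∀ l, Z.map (SimplexCategory.const ⦋0⦌ ⦋n⦌ (α l)).op z =
      Z.map (SimplexCategory.const ⦋0⦌ ⦋n⦌ (β l)).op z) :
    Z.map α.op z = Z.map β.op z := by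
  -- The nondegenerate `w` has distinct vertices, so equality of vertices of `z` is equality of
  -- values of `ρ`.
  obtain ⟨m, ρ, _, ⟨w, hw⟩, rfl⟩ := Z.exists_nonDegenerate z
  simp only [← Functor.map_comp_apply, ← op_comp] at h ⊢
  have : α ≫ ρ = β ≫ ρ := by
    ext l : 3
    exact congrArg (fun t : ⦋0⦌ ⟶ ⦋m⦌ ↦ t 0) (Nonsingular.injective_map w hw (h l))
  rw [this]

/-- A map from a nerve to a nonsingular simplicial set takes the same value on two chains that
differ in a single place, in which they take comparable values with the same image. -/
lemma Nonsingular.app_nerveChain_eq {Q : PartOrd.{u}} {Z : SSet.{u}} [Z.Nonsingular]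
    (f : PartOrd.nerveFunctor.obj Q ⟶ Z) {k : ℕ} (c c' : Fin (k + 1) →o Q) (j : Fin (k + 1))
    (hj : c j ≤ c' j) (hne : ∀ l, l ≠ j → c l = c' l)
    (h : f.app (op ⦋0⦌) (nerveChain (OrderHom.const _ (c j))) =
      f.app (op ⦋0⦌) (nerveChain (OrderHom.const _ (c' j)))) :
    f.app (op ⦋k⦌) (nerveChain c) = f.app (op ⦋k⦌) (nerveChain c') := by
  let α : ⦋k⦌ ⟶ ⦋k + 1⦌ := SimplexCategory.δ j.succ
  let β : ⦋k⦌ ⟶ ⦋k + 1⦌ := SimplexCategory.δ j.castSucc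
  -- The chain `c 0, …, c j, c' j, …, c' k`. Omitting position `j + 1` gives `c`, omitting position
  -- `j` gives `c'`, so both are faces of one simplex.
  let e : Fin (k + 2) →o Q :=
    ⟨fun l ↦ if l ≤ j.castSucc then c (j.predAbove l) else c' (j.predAbove l), by
      intro l l' hl
      have hp : j.predAbove l ≤ j.predAbove l' := Fin.predAbove_right_monotone j hl
      have hcc : ∀ l, c l ≤ c' l := fun l ↦ by
        by_cases hlj : l = j
        · subst hlj
          exact hj
        · exact (hne l hlj).le
      dsimp only
      split_ifs with h1 h2 h2
      · exact c.monotone hp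
      · exact (c.monotone hp).trans (hcc _)
      · exact absurd (hl.trans h2) h1
      · exact c'.monotone hp⟩
  have hα : e.comp α.toOrderHom = c := by
    ext l
    have h1 : j.predAbove (j.succ.succAbove l) = l :=
      congrArg (fun t : ⦋k⦌ ⟶ ⦋k⦌ ↦ t l) (SimplexCategory.δ_comp_σ_succ (i := j))
    change (if j.succ.succAbove l ≤ j.castSucc then c (j.predAbove (j.succ.succAbove l)) else
      c' (j.predAbove (j.succ.succAbove l))) = c l
    rw [h1, ite_eq_left_iff]
    refine fun h2 ↦ (hne l ?_).symm
    rintro rfl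
    exact h2 (Fin.succAbove_succ_self _).le
  have hβ : e.comp β.toOrderHom = c' := by
    ext l
    have h1 : j.predAbove (j.castSucc.succAbove l) = l :=
      congrArg (fun t : ⦋k⦌ ⟶ ⦋k⦌ ↦ t l) (SimplexCategory.δ_comp_σ_self (i := j))
    change (if j.castSucc.succAbove l ≤ j.castSucc then c (j.predAbove (j.castSucc.succAbove l))
      else c' (j.predAbove (j.castSucc.succAbove l))) = c' l
    rw [h1, ite_eq_right_iff]
    refine fun h2 ↦ hne l ?_
    rintro rfl
    rw [Fin.succAbove_castSucc_self] at h2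
    exact absurd h2 (not_le.2 Fin.castSucc_lt_succ)
  have hvert : ∀ l, Z.map (SimplexCategory.const ⦋0⦌ ⦋k + 1⦌ l).op
      (f.app (op ⦋k + 1⦌) (nerveChain e)) =
        f.app (op ⦋0⦌) (nerveChain (OrderHom.const _ (e l))) := fun l ↦
    (NatTrans.naturality_apply f _ _).symm
  have hα' : ∀ l, e (α l) = c l := DFunLike.congr_fun hα
  have hβ' : ∀ l, e (β l) = c' l := DFunLike.congr_fun hβ
  rw [← hα, ← hβ, ← map_nerveChain, ← map_nerveChain, NatTrans.naturality_apply f,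
    NatTrans.naturality_apply f]
  refine map_eq_map _ _ _ fun l ↦ ?_
  rw [hvert, hvert, hα', hβ']
  by_cases hl : l = j
  · rw [hl, h]
  · rw [hne l hl]

/-! ### The mapping cylinder of an order-preserving map -/

section Cylinder

variable {P R : PartOrd.{u}} (φ : P ⟶ R)

/-- The projection `P × [1] ⟶ P`. -/
def cylinderFst (P : PartOrd.{u}) : cylinder P ⟶ P :=
  PartOrd.ofHom (OrderHom.fst (α := P) (β := Fin 2))

/-- The map from `P × [1]` to `P` with a bottom element adjoined that collapses `P × {0}`. -/
noncomputable def cylinderTop (P : PartOrd.{u}) : cylinder P ⟶ PartOrd.of (WithBot P) :=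
  PartOrd.ofHom
    { toFun := fun x : P × Fin 2 ↦ if x.2 = 1 then (x.1 : WithBot P) else ⊥
      monotone' := fun x y h ↦ by
        dsimp only
        split_ifs with h1 h2
        · exact WithBot.coe_le_coe.2 h.1
        · exact absurd (le_antisymm (Fin.le_last y.2) (h1.symm.trans_le h.2)) h2
        · exact bot_le
        · exact le_rfl }

/-- The retraction of the reduced mapping cylinder onto its end `R`. -/
def cylinderRetraction : posetPushout (cylinderZero P) φ ⟶ R :=
  PartOrd.ofHom (posetPushoutDesc _ _ (cylinderFst P ≫ φ) (𝟙 R) rfl)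

/-- The map from the reduced mapping cylinder to `P` with a bottom element adjoined that
collapses `R`. -/
noncomputable def cylinderCollapse :
    posetPushout (cylinderZero P) φ ⟶ PartOrd.of (WithBot P) :=
  PartOrd.ofHom (posetPushoutDesc _ _ (cylinderTop P)
    (PartOrd.ofHom (OrderHom.const R (⊥ : WithBot P))) rfl)

/-- The maps `inl` and `inr` agree on the end `P × {0}` of the cylinder. -/
lemma posetPushoutInl_zero (p : P) :
    posetPushoutInl (cylinderZero P) φ ((p, 0) : P × Fin 2) =
      posetPushoutInr (cylinderZero P) φ (φ p) :=
  ConcreteCategory.congr_hom (posetPushout_condition (cylinderZero P) φ) p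

/-- The reduced mapping cylinder consists of `P × {1}` and `R`. -/
lemma posetPushout_cases (x : posetPushout (cylinderZero P) φ) :
    (∃ p : P, posetPushoutInl (cylinderZero P) φ ((p, 1) : P × Fin 2) = x) ∨
      ∃ r : R, posetPushoutInr (cylinderZero P) φ r = x := by
  induction x using Quotient.inductionOn with
  | _ x =>
  obtain ⟨p, e⟩ | r := x
  · by_cases he : e = 1
    · subst he
      exact Or.inl ⟨p, rfl⟩
    · obtain rfl : e = 0 := by lia
      exact Or.inr ⟨φ p, (posetPushoutInl_zero φ p).symm⟩
  · exact Or.inr ⟨r, rfl⟩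

lemma cylinderCollapse_inl (x : P × Fin 2) :
    cylinderCollapse φ (posetPushoutInl (cylinderZero P) φ x) =
      if x.2 = 1 then (x.1 : WithBot P) else ⊥ :=
  rfl

/-- Elements below `inl b` lift to elements below `b` if `φ` has the downward lifting property. -/
lemma exists_le_posetPushoutInl_eq (hφ : ∀ p r, r ≤ φ p → ∃ p' ≤ p, φ p' = r)
    (b : cylinder P) (x : posetPushout (cylinderZero P) φ)
    (hx : x ≤ posetPushoutInl (cylinderZero P) φ b) :
    ∃ a ≤ b, posetPushoutInl (cylinderZero P) φ a = x := by
  obtain ⟨p, e⟩ := b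
  have lift_inr : ∀ r, posetPushoutInr (cylinderZero P) φ r ≤
      posetPushoutInl (cylinderZero P) φ (p, e) → ∃ a ≤ ((p, e) : P × Fin 2),
      posetPushoutInl (cylinderZero P) φ a = posetPushoutInr (cylinderZero P) φ r := by
    intro r hr
    obtain ⟨p', hp', rfl⟩ := hφ p r ((cylinderRetraction φ).hom.monotone hr)
    exact ⟨(p', 0), ⟨hp', Fin.zero_le _⟩, posetPushoutInl_zero φ p'⟩
  obtain ⟨p', rfl⟩ | ⟨r, rfl⟩ := posetPushout_cases φ x
  -- The collapse shows that an element of `P × {1}` lies only below elements of `P × {1}`.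
  · have h : (p' : WithBot P) ≤ if e = 1 then (p : WithBot P) else ⊥ :=
      (cylinderCollapse φ).hom.monotone hx
    by_cases he : e = 1
    · subst he
      rw [if_pos rfl, WithBot.coe_le_coe] at h
      exact ⟨(p', 1), ⟨h, le_rfl⟩, rfl⟩
    · rw [if_neg he, le_bot_iff] at h
      exact absurd h WithBot.coe_ne_bot
  · exact lift_inr r hx

/-- Every simplex of the topological mapping cylinder comes from `R`, or from a chain in
`P × [1]` that ends in `P × {1}`. -/
lemma topCylinder_cases {k : ℕ} (t : (topCylinder φ) _⦋k⦌) :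
    (∃ d : Fin (k + 1) →o R, (pushout.inr (PartOrd.nerveFunctor.map (cylinderZero P))
      (PartOrd.nerveFunctor.map φ)).app (op ⦋k⦌) (nerveChain d) = t) ∨
    ∃ c : Fin (k + 1) →o P × Fin 2, (c (Fin.last k)).2 = 1 ∧
      (pushout.inl (PartOrd.nerveFunctor.map (cylinderZero P))
      (PartOrd.nerveFunctor.map φ)).app (op ⦋k⦌) (nerveChain (Q := cylinder P) c) = t := by
  have hp := (IsPushout.of_hasPushout (PartOrd.nerveFunctor.map (cylinderZero P))
      (PartOrd.nerveFunctor.map φ)).map ((evaluation _ _).obj (op ⦋k⦌))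
  obtain ⟨x, hx⟩ | ⟨x, hx⟩ := Types.eq_or_eq_of_isPushout hp t
  · obtain ⟨c, rfl⟩ := nerveChain_surjective x
    by_cases hc : (show P × Fin 2 from c (Fin.last k)).2 = 1
    · exact Or.inr ⟨c, hc, hx⟩
    · refine Or.inl ⟨(cylinderFst P ≫ φ).hom.comp c, Eq.trans ?_ hx⟩
      -- A chain ending at level 0 lies entirely there, so the gluing identifies it with its image
      -- in `R`.
      have h0 : (cylinderZero P).hom.comp ((cylinderFst P).hom.comp c) = c := by
        ext i : 2
        have hi : (show P × Fin 2 from c i).2 ≤ (show P × Fin 2 from c (Fin.last k)).2 :=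
          (c.monotone (Fin.le_last i)).2
        refine Prod.ext rfl ?_
        change 0 = (show P × Fin 2 from c i).2
        lia
      have h1 := ConcreteCategory.congr_hom (NatTrans.congr_app (pushout.condition
        (f := PartOrd.nerveFunctor.map (cylinderZero P)) (g := PartOrd.nerveFunctor.map φ))
        (op ⦋k⦌)) (nerveChain ((cylinderFst P).hom.comp c))
      exact h1.symm.trans (congrArg (fun c ↦ (pushout.inl (PartOrd.nerveFunctor.map
        (cylinderZero P)) (PartOrd.nerveFunctor.map φ)).app (op ⦋k⦌) (nerveChain c)) h0)
  · obtain ⟨d, rfl⟩ := nerveChain_surjective x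
    exact Or.inl ⟨d, hx⟩

/-- `R` is downward closed in the reduced cylinder, so a chain ending in `R` never leaves it and the
retraction recovers it. -/
lemma exists_nerveChain_inr_eq {k : ℕ} (m : Fin (k + 1) →o posetPushout (cylinderZero P) φ)
    (r : R) (hr : posetPushoutInr (cylinderZero P) φ r = m (Fin.last k)) :
    ∃ d : Fin (k + 1) →o R, (posetPushoutInr (cylinderZero P) φ).hom.comp d = m := by
  refine ⟨(cylinderRetraction φ).hom.comp m, ?_⟩
  ext i
  have hi : m i ≤ posetPushoutInr (cylinderZero P) φ r := by
    rw [hr]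
    exact m.monotone (Fin.le_last i)
  change posetPushoutInr (cylinderZero P) φ (cylinderRetraction φ (m i)) = m i
  generalize m i = x at hi
  obtain ⟨p, rfl⟩ | ⟨r', rfl⟩ := posetPushout_cases φ x
  · exact absurd (le_bot_iff.1 ((cylinderCollapse φ).hom.monotone hi)) WithBot.coe_ne_bot
  · rfl

end Cylinder

/-! ### Chains identified by maps to nonsingular simplicial sets -/

/-- The chain obtained from `c` by raising the value at `j` to `x`. -/
def chainUpdate {Q : Type*} [PartialOrder Q] {k : ℕ} (c : Fin (k + 1) →o Q) (j : Fin (k + 1))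
    (x : Q) (hj : c j ≤ x) (hx : ∀ l, j < l → x ≤ c l) : Fin (k + 1) →o Q where
  toFun := Function.update c j x
  monotone' l l' h := by
    by_cases hl : l = j <;> by_cases hl' : l' = j
    · rw [hl, hl']
    · subst hl
      rw [Function.update_self, Function.update_of_ne hl']
      exact hx l' (lt_of_le_of_ne h (Ne.symm hl'))
    · subst hl'
      rw [Function.update_self, Function.update_of_ne hl]
      exact (c.monotone h).trans hj
    · rw [Function.update_of_ne hl, Function.update_of_ne hl']
      exact c.monotone h

lemma chainUpdate_self {Q : Type*} [PartialOrder Q] {k : ℕ} (c : Fin (k + 1) →o Q)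
    (j : Fin (k + 1)) (x : Q) (hj : c j ≤ x) (hx : ∀ l, j < l → x ≤ c l) :
    chainUpdate c j x hj hx j = x :=
  Function.update_self ..

lemma chainUpdate_of_ne {Q : Type*} [PartialOrder Q] {k : ℕ} (c : Fin (k + 1) →o Q)
    (j : Fin (k + 1)) (x : Q) (hj : c j ≤ x) (hx : ∀ l, j < l → x ≤ c l) {l : Fin (k + 1)}
    (hl : l ≠ j) : chainUpdate c j x hj hx l = c l :=
  Function.update_of_ne hl ..

section

variable {P R : PartOrd.{u}} {φ : P ⟶ R} {Z : SSet.{u}} [Z.Nonsingular]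
  {f : PartOrd.nerveFunctor.obj (cylinder P) ⟶ Z} {g : PartOrd.nerveFunctor.obj R ⟶ Z}

/-- A map from the topological mapping cylinder of `φ` to a nonsingular simplicial set is
unchanged when a vertex in `P × {0}` is raised without changing its image in `R`. -/
lemma app_nerveChain_chainUpdate
    (w : PartOrd.nerveFunctor.map (cylinderZero P) ≫ f = PartOrd.nerveFunctor.map φ ≫ g)
    {k : ℕ} (c : Fin (k + 1) →o P × Fin 2) (j : Fin (k + 1)) (m : P) (hc : (c j).2 = 0)
    (hm : φ m = φ (c j).1) (hj : c j ≤ (m, 0)) (hx : ∀ l, j < l → (m, 0) ≤ c l) :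
    f.app (op ⦋k⦌) (nerveChain (Q := cylinder P) (chainUpdate c j (m, 0) hj hx)) =
      f.app (op ⦋k⦌) (nerveChain (Q := cylinder P) c) := by
  -- By the gluing condition, the value of `f` at a vertex `(p, 0)` depends only on `φ p`.
  have hv : ∀ p, f.app (op ⦋0⦌) (nerveChain (Q := cylinder P)
      (OrderHom.const _ ((p, 0) : P × Fin 2))) =
      g.app (op ⦋0⦌) (nerveChain (OrderHom.const _ (φ p))) := fun p ↦
    ConcreteCategory.congr_hom (NatTrans.congr_app w (op ⦋0⦌))
      (nerveChain (OrderHom.const _ p))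
  have hupd : chainUpdate c j (m, 0) hj hx j = (m, 0) := chainUpdate_self ..
  refine (Nonsingular.app_nerveChain_eq (Q := cylinder P) f c _ j (hj.trans_eq hupd.symm)
    (fun l hl ↦ (chainUpdate_of_ne _ _ _ _ _ hl).symm) ?_).symm
  let F : P × Fin 2 → Z _⦋0⦌ := fun x ↦
    f.app (op ⦋0⦌) (nerveChain (Q := cylinder P) (OrderHom.const _ x))
  have hcj : c j = ((c j).1, 0) := Prod.ext rfl hc
  have hF : F ((c j).1, 0) = F (m, 0) :=
    (hv _).trans ((congrArg (fun r ↦ g.app (op ⦋0⦌) (nerveChain (OrderHom.const _ r)))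
      hm.symm).trans (hv m).symm)
  exact (congrArg F hcj).trans (hF.trans (congrArg F hupd.symm))

/-- A map from the topological mapping cylinder of `φ` to a nonsingular simplicial set identifies
chains with the same image in the reduced mapping cylinder, provided that elements under `p` with
the same image in `R` have a common upper bound under `p` with that image. -/
lemma app_nerveChain_cylinder_eq
    (hφ : ∀ p p₁ p₂, p₁ ≤ p → p₂ ≤ p → φ p₁ = φ p₂ →
      ∃ m ≤ p, p₁ ≤ m ∧ p₂ ≤ m ∧ φ m = φ p₁)
    (w : PartOrd.nerveFunctor.map (cylinderZero P) ≫ f = PartOrd.nerveFunctor.map φ ≫ g)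
    {k : ℕ} (c c' : Fin (k + 1) →o P × Fin 2) (h₁ : ∀ l, φ (c l).1 = φ (c' l).1)
    (h₂ : ∀ l, (c l).2 = (c' l).2) (h₃ : ∀ l, (c l).2 = 1 → c l = c' l)
    (hlast : (c (Fin.last k)).2 = 1) :
    f.app (op ⦋k⦌) (nerveChain (Q := cylinder P) c) =
      f.app (op ⦋k⦌) (nerveChain (Q := cylinder P) c') := by
  -- Induction on the position `j` from which the chains agree. The case `j = k` applies because the
  -- last entries are at level 1.
  suffices H : ∀ (j : ℕ), j ≤ k → ∀ (c c' : Fin (k + 1) →o P × Fin 2),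
      (∀ l, φ (c l).1 = φ (c' l).1) → (∀ l, (c l).2 = (c' l).2) →
      (∀ l, (c l).2 = 1 → c l = c' l) → (∀ l : Fin (k + 1), j ≤ l.val → c l = c' l) →
      f.app (op ⦋k⦌) (nerveChain (Q := cylinder P) c) =
        f.app (op ⦋k⦌) (nerveChain (Q := cylinder P) c') by
    refine H k le_rfl c c' h₁ h₂ h₃ fun l hl ↦ ?_
    obtain rfl : l = Fin.last k := le_antisymm (Fin.le_last l) hl
    exact h₃ _ hlast
  clear h₁ h₂ h₃ hlast c c'
  intro j
  induction j with
  | zero =>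
    intro _ c c' _ _ _ h
    obtain rfl : c = c' := OrderHom.ext _ _ (funext fun l ↦ h l (Nat.zero_le _))
    rfl
  | succ j ih =>
    intro hjk c c' h₁ h₂ h₃ h₄
    let J : Fin (k + 1) := ⟨j, by lia⟩
    let J' : Fin (k + 1) := ⟨j + 1, by lia⟩
    by_cases hJ : (c J).2 = 1
    · refine ih (by lia) c c' h₁ h₂ h₃ fun l hl ↦ ?_
      obtain hl | hl := hl.eq_or_lt
      · obtain rfl : l = J := Fin.ext hl.symm
        exact h₃ _ hJ
      · exact h₄ l hl
    have hJ0 : (c J).2 = 0 := by lia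
    have hJ0' : (c' J).2 = 0 := by rw [← h₂, hJ0]
    have hJJ' : J ≤ J' := Nat.le_succ j
    have hlt : ∀ l, J < l → J' ≤ l := fun _ h ↦ Nat.succ_le_of_lt h
    -- The chains share the entry at `J'`, so their entries at `J` have a common bound `m` under it.
    -- Raising both to `(m, 0)` preserves the values of `f` and makes the chains agree from `J` on.
    obtain ⟨m, hm, hm₁, hm₂, hm₃⟩ := hφ (c J').1 (c J).1 (c' J).1 (c.monotone hJJ').1
      ((c'.monotone hJJ').1.trans_eq (by rw [h₄ J' le_rfl])) (h₁ J)
    have hx : ∀ l, J < l → (m, 0) ≤ c l := fun l hl ↦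
      ⟨hm.trans (c.monotone (hlt l hl)).1, Fin.zero_le _⟩
    have hx' : ∀ l, J < l → (m, 0) ≤ c' l := fun l hl ↦ by
      rw [← h₄ l (hlt l hl)]
      exact hx l hl
    let d : Fin (k + 1) →o P × Fin 2 := chainUpdate c J (m, 0) ⟨hm₁, hJ0.le⟩ hx
    let d' : Fin (k + 1) →o P × Fin 2 := chainUpdate c' J (m, 0) ⟨hm₂, hJ0'.le⟩ hx'
    have hdJ : d J = (m, 0) := chainUpdate_self ..
    have hdJ' : d' J = (m, 0) := chainUpdate_self ..
    have hd : d J = d' J := hdJ.trans hdJ'.symm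
    have hne : ∀ l, l ≠ J → d l = c l := fun l hl ↦ chainUpdate_of_ne _ _ _ _ _ hl
    have hne' : ∀ l, l ≠ J → d' l = c' l := fun l hl ↦ chainUpdate_of_ne _ _ _ _ _ hl
    refine (app_nerveChain_chainUpdate w c J m hJ0 hm₃ ⟨hm₁, hJ0.le⟩ hx).symm.trans
      (Eq.trans (ih (by lia) d d' (fun l ↦ ?_) (fun l ↦ ?_) (fun l ↦ ?_) (fun l hl ↦ ?_))
        (app_nerveChain_chainUpdate w c' J m hJ0' (hm₃.trans (h₁ J)) ⟨hm₂, hJ0'.le⟩ hx'))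
    all_goals obtain rfl | hlJ := eq_or_ne l J
    · rw [hd]
    · rw [hne l hlJ, hne' l hlJ, h₁]
    · rw [hd]
    · rw [hne l hlJ, hne' l hlJ, h₂]
    · exact fun _ ↦ hd
    · rw [hne l hlJ, hne' l hlJ]
      exact h₃ l
    · exact hd
    · rw [hne l hlJ, hne' l hlJ]
      exact h₄ l (lt_of_le_of_ne hl fun e ↦ hlJ (Fin.ext e.symm))

end

/-! ### Bijectivity of the comparison map -/

variable {P R : PartOrd.{u}} (φ : P ⟶ R)

lemma cr_app_inl {k : ℕ} (c : Fin (k + 1) →o cylinder P) :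
    (cr φ).app (op ⦋k⦌) ((pushout.inl (PartOrd.nerveFunctor.map (cylinderZero P))
      (PartOrd.nerveFunctor.map φ)).app (op ⦋k⦌) (nerveChain c)) =
      nerveChain ((posetPushoutInl (cylinderZero P) φ).hom.comp c) := by
  have h : pushout.inl (PartOrd.nerveFunctor.map (cylinderZero P)) (PartOrd.nerveFunctor.map φ) ≫
      cr φ = PartOrd.nerveFunctor.map (posetPushoutInl (cylinderZero P) φ) :=
    pushout.inl_desc _ _ _
  exact ConcreteCategory.congr_hom (NatTrans.congr_app h (op ⦋k⦌)) (nerveChain c)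

lemma cr_app_inr {k : ℕ} (d : Fin (k + 1) →o R) :
    (cr φ).app (op ⦋k⦌) ((pushout.inr (PartOrd.nerveFunctor.map (cylinderZero P))
      (PartOrd.nerveFunctor.map φ)).app (op ⦋k⦌) (nerveChain d)) =
      nerveChain ((posetPushoutInr (cylinderZero P) φ).hom.comp d) := by
  have h : pushout.inr (PartOrd.nerveFunctor.map (cylinderZero P)) (PartOrd.nerveFunctor.map φ) ≫
      cr φ = PartOrd.nerveFunctor.map (posetPushoutInr (cylinderZero P) φ) :=
    pushout.inr_desc _ _ _
  exact ConcreteCategory.congr_hom (NatTrans.congr_app h (op ⦋k⦌)) (nerveChain d)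

lemma cr_app_surjective (hφ : ∀ p r, r ≤ φ p → ∃ p' ≤ p, φ p' = r) (k : ℕ) :
    Function.Surjective ((cr φ).app (op ⦋k⦌)) := by
  intro x
  obtain ⟨m, rfl⟩ := nerveChain_surjective (Q := posetPushout (cylinderZero P) φ) x
  obtain ⟨p, hp⟩ | ⟨r, hr⟩ := posetPushout_cases φ (m (Fin.last k))
  · obtain ⟨c, rfl⟩ := exists_chain_lift _ (exists_le_posetPushoutInl_eq φ hφ) m _ hp
    exact ⟨_, cr_app_inl φ c⟩
  · obtain ⟨d, rfl⟩ := exists_nerveChain_inr_eq φ m r hr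
    exact ⟨_, cr_app_inr φ d⟩

/-- Simplices of the topological mapping cylinder with the same image in the reduced one have the
same image in every nonsingular simplicial set. -/
lemma app_eq_of_cr_app_eq
    (hφ : ∀ p p₁ p₂, p₁ ≤ p → p₂ ≤ p → φ p₁ = φ p₂ →
      ∃ m ≤ p, p₁ ≤ m ∧ p₂ ≤ m ∧ φ m = φ p₁)
    {k : ℕ} (t t' : (topCylinder φ) _⦋k⦌)
    (h : (cr φ).app (op ⦋k⦌) t = (cr φ).app (op ⦋k⦌) t')
    {Z : SSet.{u}} [Z.Nonsingular] (f : topCylinder φ ⟶ Z) :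
    f.app (op ⦋k⦌) t = f.app (op ⦋k⦌) t' := by
  have not_inl_inr : ∀ (c : Fin (k + 1) →o cylinder P) (d : Fin (k + 1) →o R),
      (show P × Fin 2 from c (Fin.last k)).2 = 1 →
      (posetPushoutInl (cylinderZero P) φ).hom.comp c ≠
        (posetPushoutInr (cylinderZero P) φ).hom.comp d := by
    intro c d hc h
    have h' := congrArg (cylinderCollapse φ) (DFunLike.congr_fun h (Fin.last k))
    have h'' := (cylinderCollapse_inl φ (c (Fin.last k))).symm.trans h'
    rw [if_pos hc] at h''
    exact WithBot.coe_ne_bot h''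
  obtain ⟨d, rfl⟩ | ⟨c, hc, rfl⟩ := topCylinder_cases φ t <;>
    obtain ⟨d', rfl⟩ | ⟨c', hc', rfl⟩ := topCylinder_cases φ t'
  · rw [cr_app_inr, cr_app_inr] at h
    have hd : d = d' := OrderHom.ext _ _ (funext fun l ↦ congrArg (cylinderRetraction φ)
      (DFunLike.congr_fun (nerveChain_injective h) l))
    rw [hd]
  · rw [cr_app_inr] at h
    exact absurd (nerveChain_injective (h.trans (cr_app_inl φ c'))).symm (not_inl_inr _ _ hc')
  · rw [cr_app_inr] at h
    exact absurd (nerveChain_injective ((cr_app_inl φ c).symm.trans h)) (not_inl_inr _ _ hc)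
  · have hcc := nerveChain_injective ((cr_app_inl φ c).symm.trans (h.trans (cr_app_inl φ c')))
    -- The collapse recovers the levels and the entries at level 1; the retraction recovers the
    -- images in `R` of all entries.
    have hcol : ∀ l, (if (c l).2 = 1 then ((c l).1 : WithBot P) else ⊥) =
        if (c' l).2 = 1 then ((c' l).1 : WithBot P) else ⊥ := fun l ↦
      congrArg (cylinderCollapse φ) (DFunLike.congr_fun hcc l)
    have h₂ : ∀ l, (c l).2 = (c' l).2 := fun l ↦ by
      have := hcol l
      split_ifs at this with h1 h2 h2
      · rw [h1, h2]
      · exact absurd this WithBot.coe_ne_bot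
      · exact absurd this.symm WithBot.coe_ne_bot
      · lia
    have h₃ : ∀ l, (c l).2 = 1 → c l = c' l := fun l h1 ↦ by
      have := hcol l
      rw [if_pos h1, if_pos ((h₂ l).symm.trans h1), WithBot.coe_inj] at this
      exact Prod.ext this (h₂ l)
    have w : PartOrd.nerveFunctor.map (cylinderZero P) ≫ (pushout.inl _ _ ≫ f) =
        PartOrd.nerveFunctor.map φ ≫ (pushout.inr _ _ ≫ f) :=
      pushout.condition_assoc f
    exact app_nerveChain_cylinder_eq hφ w c c'
      (fun l ↦ congrArg (cylinderRetraction φ) (DFunLike.congr_fun hcc l)) h₂ h₃ hc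

/-- The map `dcr : D T(Nφ) ⟶ M(Nφ)` is an isomorphism if elements under `φ p` lift to elements
under `p`, and elements under `p` with the same image have a common upper bound under `p` with
that image. -/
theorem isIso_dcr (hφ : ∀ p r, r ≤ φ p → ∃ p' ≤ p, φ p' = r)
    (hφ' : ∀ p p₁ p₂, p₁ ≤ p → p₂ ≤ p → φ p₁ = φ p₂ →
      ∃ m ≤ p, p₁ ≤ m ∧ p₂ ≤ m ∧ φ m = φ p₁) :
    IsIso (dcr φ) := by
  rw [NatTrans.isIso_iff_isIso_app]
  rintro ⟨⟨k⟩⟩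
  rw [isIso_iff_bijective]
  constructor
  · intro a b hab
    induction a using Quotient.inductionOn with
    | _ t =>
    induction b using Quotient.inductionOn with
    -- Equality in the desingularization means equality under every map to a nonsingular simplicial
    -- set.
    | _ t' => exact Quotient.sound fun Z _ f ↦ app_eq_of_cr_app_eq φ hφ' t t' hab f
  · intro x
    obtain ⟨t, rfl⟩ := cr_app_surjective φ hφ k x
    exact ⟨Quotient.mk _ t, rfl⟩

/-- For a simplicial map `f` to a regular simplicial set, `dcr : D T(B f) ⟶ M(B f)` is an
isomorphism. -/
theorem isIso_dcr_sharp_map {W X : SSet.{u}} (hX : X.IsRegular) (f : W ⟶ X) :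
    IsIso (dcr (sharp.map f)) :=
  isIso_dcr _ (exists_le_sharp_map_eq f) (hX.exists_le_sharp_map_eq f)

end SSet

theorem theorem2 (X : SSet.{u}) (hX : X.IsRegular) (n : ℕ) (y : X.obj (op ⦋n⦌)) :
    IsIso (SSet.dcr (SSet.sharp.map (SSet.yonedaEquiv.symm y))) :=
  SSet.isIso_dcr_sharp_map hX _
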